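/- **Polytope scheduling.** There are finitely many jobs $j\in J$ with processing requirements $p_j>0$, release dates $r_j\ge 0$ and weights $w_j>0$, and a polytope (bounded set) $\mathcal P=\{y\in\mathbb R^{J}_{\ge 0} : By\le \mathbf 1\}$, where $B\in\mathbb R_{\ge 0}^{D\times J}$. A schedule chooses, measurably in $t\ge 0$, a rate vector $y(t)\in\mathcal P$. The completion time $C_j$ of job $j$ is the earliest time $t'\ge r_j$ with $\int_{r_j}^{t'}y_j(t)\,dt\ge p_j$ ($C_j=\infty$ if there is none). The cost of a schedule is $\sum_j w_jC_j$, and $\mathsf{opt}$ denotes the infimum of the costs of all schedules. Job $j$ is active at time $t$ if $r_j\le t<C_j$; $J(t)$ is the set of active jobs. **Proportional fairness (PF) with an adversary.** At every time $t$, PF selects the vector $y(t)\in\mathcal P$, supported on $J(t)$, that maximizes $\sum_{j\in J(t)}w_j\log y_j$ (with $\log 0=-\infty$). An adversary then chooses, measurably in $t$, a set $N(t)\subseteq J(t)$, and the jobs are processed at the rates $\hat y_j(t)=y_j(t)$ for $j\notin N(t)$ and $\hat y_j(t)=0$ for $j\in N(t)$; completion times and active jobs of the run are those determined by $\hat y$.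 In the $\beta$-robust problem the adversary must respect, at all times $t$, $$\sum_{j\in N(t)}w_j\le\beta\sum_{j\in J(t)}w_j .$$ In the unweighted case (all $w_j=1$, objective $\sum_jC_j$) this says $|N(t)|\le\beta\,|J(t)|$. **Theorem.** For every $\beta\in[0,1)$, PF is $27/(1-\beta)^3$-competitive for $\beta$-robust polytope scheduling: for every instance and every choice of the adversary within its budget, the completion times of the PF run satisfy $$\sum_j w_jC_j\le\frac{27}{(1-\beta)^3}\,\mathsf{opt}.$$ In particular, in the unweighted case, PF is $27/(1-\beta)^3$-competitive for total completion time when the adversary may nullify up to $\beta|J(t)|$ active jobs at every time $t$. -/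

import Mathlib

open MeasureTheory
open scoped ENNReal

/-- The downward-closed set `{y ≥ 0 | B y ≤ 1}` of feasible vectors of processing rates. -/
def ratePolytope {ι δ : Type*} [Fintype ι] (B : Matrix δ ι ℝ) : Set (ι → ℝ) :=
  {y | (∀ j, 0 ≤ y j) ∧ ∀ d, ∑ j, B d j * y j ≤ 1}

/-- An instance of the polytope scheduling problem: the jobs are the elements of `ι`, the packing
constraints are indexed by `δ`, and job `j` has processing requirement `p j` and release date
`r j`. -/
structure PolytopeScheduling (ι δ : Type*) [Fintype ι] where
  B : Matrix δ ι ℝ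
  B_nonneg : ∀ d j, 0 ≤ B d j
  bounded : Bornology.IsBounded (ratePolytope B)
  p : ι → ℝ
  p_pos : ∀ j, 0 < p j
  r : ι → ℝ
  r_nonneg : ∀ j, 0 ≤ r j

namespace PolytopeScheduling

variable {ι δ : Type*} [Fintype ι]

/-- The completion time of job `j` when the processing rates at time `t` are `y t`: the earliest
time `t ≥ r j` with `∫ s in r j..t, y s j ≥ p j`, and `∞` if there is no such time. -/
noncomputable def completionTime (I : PolytopeScheduling ι δ) (y : ℝ → ι → ℝ) (j : ι) : ℝ≥0∞ :=
  ⨅ (t : ℝ) (_ : I.r j ≤ t ∧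
    ENNReal.ofReal (I.p j) ≤ ∫⁻ s in Set.Icc (I.r j) t, ENNReal.ofReal (y s j)),
    ENNReal.ofReal t

/-- The total weighted completion time. -/
noncomputable def cost (I : PolytopeScheduling ι δ) (w : ι → ℝ) (y : ℝ → ι → ℝ) : ℝ≥0∞ :=
  ∑ j, ENNReal.ofReal (w j) * I.completionTime y j

/-- A feasible (offline) schedule: measurable rates in the polytope at every time. Rates given to
jobs that are not released, or already complete, have no effect on completion times. -/
def IsSchedule (I : PolytopeScheduling ι δ) (y : ℝ → ι → ℝ) : Prop :=
  (∀ j, Measurable fun t => y t j) ∧ ∀ t, 0 ≤ t → y t ∈ ratePolytope I.B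

/-- The offline optimum of the instance, where no rates are nullified. -/
noncomputable def opt (I : PolytopeScheduling ι δ) (w : ι → ℝ) : ℝ≥0∞ :=
  ⨅ (y : ℝ → ι → ℝ) (_ : I.IsSchedule y), I.cost w y

open Classical in
/-- The set `J(t)` of active jobs, i.e. jobs released and not yet complete, at time `t`. -/
noncomputable def active (I : PolytopeScheduling ι δ) (y : ℝ → ι → ℝ) (t : ℝ) : Finset ι :=
  Finset.univ.filter fun j => I.r j ≤ t ∧ ENNReal.ofReal t < I.completionTime y j

/-- The feasible points of the convex program for the job set `J` at which its objective is finite;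
the points of the polytope are extended by zero outside `J`. -/
def cpFeasible (I : PolytopeScheduling ι δ) (J : Finset ι) : Set (ι → ℝ) :=
  {y | y ∈ ratePolytope I.B ∧ (∀ j ∈ J, 0 < y j) ∧ ∀ j, j ∉ J → y j = 0}

/-- `y` is the proportionally fair allocation for the job set `J`: it maximizes
`∑ j ∈ J, w j * log (y j)` over the polytope, where `log 0 = -∞`. -/
def IsPF (I : PolytopeScheduling ι δ) (w : ι → ℝ) (J : Finset ι) (y : ι → ℝ) : Prop :=
  y ∈ I.cpFeasible J ∧
    ∀ z ∈ I.cpFeasible J, ∑ j ∈ J, w j * Real.log (z j) ≤ ∑ j ∈ J, w j * Real.log (y j)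

end PolytopeScheduling

open Classical in
/-- The rates that result from `y` when at each time `t` the rates of the jobs in `N t` are
nullified. -/
noncomputable def nullify {ι : Type*} (y : ℝ → ι → ℝ) (N : ℝ → Finset ι) : ℝ → ι → ℝ :=
  fun t j => if j ∈ N t then 0 else y t j

namespace PolytopeScheduling

variable {ι δ : Type*} [Fintype ι]

/-- A run of proportional fairness with an adversary: `y t` is the allocation that proportional
fairness selects at time `t` for the currently active jobs, and `N t` is the set of active jobs
that the adversary nullifies at time `t`. Which jobs are active is determined by the resulting
rates `nullify y N`. -/
structure IsRobustPFRun (I : PolytopeScheduling ι δ) (w : ι → ℝ) (y : ℝ → ι → ℝ)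
    (N : ℝ → Finset ι) : Prop where
  measurable : ∀ j, MeasurableSet {t | j ∈ N t}
  isPF : ∀ t, 0 ≤ t → I.IsPF w (I.active (nullify y N) t) (y t)
  subset : ∀ t, 0 ≤ t → N t ⊆ I.active (nullify y N) t

end PolytopeScheduling

/-!
The proof is a dual fitting argument against the linear relaxation of the offline problem, carried
out without multipliers for the packing constraints.

Let `y` be the proportionally fair allocation for the active jobs `J(t)`, of total weight `W(t)`. Its
first-order optimality (`IsPF.sum_mul_div_le`) says that at the prices `w j / y j` no point of the
polytope is worth more than `W(t)`. Let `ζ(t)` be a quantile of the relative rates `y j / p j` among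
the jobs that are not nullified (`exists_price`): active jobs of weight at least `lam * W(t)` have
`y j ≤ ζ(t) * p j`, and jobs of weight at least `mu * W(t)` that really are processed have
`y j ≥ ζ(t) * p j`, where `lam + mu = 1 - β`.

Let `α j` be `w j` times the length of the time before `C j` during which `j` is unreleased or has
`y j ≤ ζ(t) * p j`. Then `∑ α j ≥ lam * ALG`, where `ALG` is the cost of the run. Since
`w j = (w j / y j) * y j ≤ p j * (w j / y j) * ζ(t)` at the counted times after release,
`α j ≤ w j * v + p j * ∫ (w j / y j) * ζ(t)`, with the integral over the times `t ≥ v` at which `j` is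
active, for every `v ≥ r j` (`IsPricedRun.volume_cheapTimes_le`). With `v = s * u` this is averaged
over the times `u` at which an offline schedule processes `j`, and summed over `j`. By the
first-order condition the last terms add up to at most `∫_u ∫_{t ≥ s u} W(t) * ζ(t)`. By the choice of
the quantile, `W(t) * ζ(t)` is at most `1 / mu` times the weighted sum of the relative processing
rates, so the inner integral is at most `1 / mu` times the weight of the jobs unfinished at time
`s * u`, and the double integral is at most `ALG / (mu * s)`. Altogether
`lam * ALG ≤ s * OPT + ALG / (mu * s)` (`IsPricedRun.le_of_schedule`), and
`lam = 2 * (1 - β) / 3`, `mu = (1 - β) / 3`, `s = 9 / (1 - β) ^ 2` give the ratio `27 / (1 - β) ^ 3`.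

All costs are truncated at a horizon `T`, so that they are finite and can be cancelled, and `T` tends
to infinity at the end. The allocation is measurable in time because it is a function of the set of
active jobs, by uniqueness of the maximizer (`IsPF.unique`).
-/

open Filter Topology

/-! ### Quantiles and measurability -/

/-- A weighted quantile of `q` on `M` exists and is attained at a point of `M`. -/
theorem exists_weighted_quantile {ι : Type*} {M : Finset ι} (hM : M.Nonempty) (w q : ι → ℝ)
    {a b : ℝ} (ha : 0 ≤ a) (hb : 0 ≤ b) (hab : a + b ≤ ∑ j ∈ M, w j) :
    ∃ i ∈ M, a ≤ ∑ j ∈ M with q j ≤ q i, w j ∧ b ≤ ∑ j ∈ M with q i ≤ q j, w j := by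
  classical
  obtain ⟨m, hm, hmax⟩ := M.exists_max_image q hM
  have hne : (M.filter fun i => a ≤ ∑ j ∈ M with q j ≤ q i, w j).Nonempty := by
    refine ⟨m, Finset.mem_filter.2 ⟨hm, ?_⟩⟩
    rw [Finset.filter_true_of_mem hmax]
    linarith
  -- `q i` is the least value of `q` whose lower set has weight at least `a`
  obtain ⟨i, hi, hmin⟩ := Finset.exists_min_image _ q hne
  rw [Finset.mem_filter] at hi
  refine ⟨i, hi.1, hi.2, ?_⟩
  have hsplit := Finset.sum_filter_add_sum_filter_not M (fun j => q i ≤ q j) w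
  suffices h : ∑ j ∈ M with ¬ q i ≤ q j, w j ≤ a by linarith
  rcases (M.filter fun j => ¬ q i ≤ q j).eq_empty_or_nonempty with he | hne'
  · rw [he, Finset.sum_empty]; exact ha
  · obtain ⟨k, hk, hkmax⟩ := Finset.exists_max_image _ q hne'
    rw [Finset.mem_filter] at hk
    have hk' : ∑ j ∈ M with q j ≤ q k, w j < a := by
      by_contra! h
      exact hk.2 (hmin k (Finset.mem_filter.2 ⟨hk.1, h⟩))
    refine le_of_eq_of_le (Finset.sum_congr ?_ fun _ _ => rfl) hk'.le
    ext j
    simp only [Finset.mem_filter, and_congr_right_iff]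
    refine fun hj => ⟨fun h => hkmax j (Finset.mem_filter.2 ⟨hj, h⟩), fun h h' => hk.2 (h'.trans h)⟩

theorem measurable_comp_of_finite {S : Type*} [Finite S] {σ : ℝ → S}
    (hσ : ∀ s, MeasurableSet (σ ⁻¹' {s})) (F : S → ℝ) : Measurable fun t => F (σ t) := by
  let _ : MeasurableSpace S := ⊤
  exact measurable_from_top.comp (measurable_to_countable' hσ)

theorem measurableSet_fiber {ι : Type*} [Finite ι] {A : ℝ → Finset ι}
    (hA : ∀ j, MeasurableSet {t | j ∈ A t}) (s : Finset ι) : MeasurableSet (A ⁻¹' {s}) := by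
  have : A ⁻¹' {s} = ⋂ j, {t | j ∈ A t ↔ j ∈ s} := by
    ext t
    simp [Finset.ext_iff]
  rw [this]
  refine MeasurableSet.iInter fun j => ?_
  by_cases h : j ∈ s
  · simpa [h] using hA j
  · simpa [h, Set.compl_def] using (hA j).compl

open Classical in
theorem sum_ofReal_mul_volume {ι : Type*} [Fintype ι] {w : ι → ℝ} (hw : ∀ j, 0 ≤ w j)
    {S : ι → Set ℝ} (hS : ∀ j, MeasurableSet (S j)) :
    ∑ j, ENNReal.ofReal (w j) * volume (S j) =
      ∫⁻ t, ENNReal.ofReal (∑ j with t ∈ S j, w j) := by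
  have h : ∀ t, ENNReal.ofReal (∑ j with t ∈ S j, w j) =
      ∑ j, (S j).indicator (fun _ => ENNReal.ofReal (w j)) t := by
    intro t
    rw [ENNReal.ofReal_sum_of_nonneg fun j _ => hw j, Finset.sum_filter]
    rfl
  simp_rw [h]
  rw [lintegral_finsetSum _ fun j _ => measurable_const.indicator (hS j)]
  exact Finset.sum_congr rfl fun j _ => (lintegral_indicator_const (hS j) _).symm

theorem sum_indicator_setOf_mem {ι : Type*} [Fintype ι] (A : ℝ → Finset ι)
    (f : ι → ℝ → ℝ≥0∞) (t : ℝ) : ∑ j, {t | j ∈ A t}.indicator (f j) t = ∑ j ∈ A t, f j t := by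
  classical
  simp [Set.indicator_apply, Finset.sum_ite_mem]

/-- The times in `[0, T]` before the (possibly infinite) time `c`; the measure of this set is the
truncation `min c T` for `T ≥ 0`. -/
def timesBefore (c : ℝ≥0∞) (T : ℝ) : Set ℝ := {t | 0 ≤ t ∧ t ≤ T ∧ ENNReal.ofReal t < c}

theorem measurableSet_timesBefore (c : ℝ≥0∞) (T : ℝ) : MeasurableSet (timesBefore c T) :=
  measurableSet_Ici.inter (measurableSet_Iic.inter
    (measurableSet_lt ENNReal.measurable_ofReal measurable_const))

theorem volume_timesBefore_ne_top (c : ℝ≥0∞) (T : ℝ) : volume (timesBefore c T) ≠ ⊤ :=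
  ((measure_mono fun _ ht => ⟨ht.1, ht.2.1⟩ : volume (timesBefore c T) ≤
    volume (Set.Icc 0 T)).trans_lt measure_Icc_lt_top).ne

theorem tendsto_volume_timesBefore (c : ℝ≥0∞) :
    Tendsto (fun n : ℕ => volume (timesBefore c n)) atTop (𝓝 c) := by
  have hmono : Monotone fun n : ℕ => timesBefore c n := fun m n hmn t ht =>
    ⟨ht.1, ht.2.1.trans (by exact_mod_cast hmn), ht.2.2⟩
  have hU : ⋃ n : ℕ, timesBefore c n = {t | 0 ≤ t ∧ ENNReal.ofReal t < c} := by
    ext t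
    simp only [timesBefore, Set.mem_iUnion, Set.mem_ofPred_eq]
    refine ⟨fun ⟨_, h0, _, h⟩ => ⟨h0, h⟩, fun ⟨h0, h⟩ => ?_⟩
    obtain ⟨n, hn⟩ := exists_nat_ge t
    exact ⟨n, h0, hn, h⟩
  have hvol : volume {t | 0 ≤ t ∧ ENNReal.ofReal t < c} = c := by
    rcases eq_or_ne c ⊤ with rfl | hc
    · have : {t : ℝ | 0 ≤ t ∧ ENNReal.ofReal t < ⊤} = Set.Ici 0 := by ext t; simp
      rw [this, Real.volume_Ici]
    · have : {t : ℝ | 0 ≤ t ∧ ENNReal.ofReal t < c} = Set.Ico 0 c.toReal := by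
        ext t
        simp only [Set.mem_ofPred_eq, Set.mem_Ico]
        exact and_congr_right fun h0 => ENNReal.ofReal_lt_iff_lt_toReal h0 hc
      rw [this, Real.volume_Ico, sub_zero, ENNReal.ofReal_toReal hc]
  have := tendsto_measure_iUnion_atTop (μ := volume) hmono
  rwa [hU, hvol] at this

namespace PolytopeScheduling

variable {ι δ : Type*} [Fintype ι]

/-! ### The proportionally fair allocation -/

/-- First-order optimality of the proportionally fair allocation. With `w j / y j` read as the
price of job `j`, no feasible rate vector is worth more than the total weight of `J`, which is the
worth of `y` itself. -/
theorem IsPF.sum_mul_div_le {I : PolytopeScheduling ι δ} {w : ι → ℝ} (hw : ∀ j, 0 ≤ w j)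
    {J : Finset ι} {y z : ι → ℝ} (hy : I.IsPF w J y) (hz : z ∈ ratePolytope I.B) :
    ∑ j ∈ J, w j * (z j / y j) ≤ ∑ j ∈ J, w j := by
  classical
  obtain ⟨⟨hyP, hypos, hyzero⟩, hmax⟩ := hy
  set a : ι → ℝ := fun j => z j / y j - 1 with ha
  -- `y` is compared with `(1 - ε) y + ε z` cut off outside `J`, which stays feasible because `B ≥ 0`
  have key : ∀ ε ∈ Set.Ioo (0 : ℝ) 1, ∑ j ∈ J, w j * (a j / (1 + ε * a j)) ≤ 0 := by
    intro ε hε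
    obtain ⟨hε0, hε1⟩ := hε
    have hfeas : (fun j => if j ∈ J then (1 - ε) * y j + ε * z j else 0) ∈ I.cpFeasible J := by
      refine ⟨⟨fun j => ?_, fun d => ?_⟩, fun j hj => ?_, fun j hj => ?_⟩
      · dsimp only
        split_ifs
        · have := hyP.1 j; have := hz.1 j
          have : 0 ≤ 1 - ε := by linarith
          positivity
        · exact le_rfl
      · calc ∑ j, I.B d j * (if j ∈ J then (1 - ε) * y j + ε * z j else 0)
            ≤ ∑ j, ((1 - ε) * (I.B d j * y j) + ε * (I.B d j * z j)) := by
              refine Finset.sum_le_sum fun j _ => ?_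
              have := hyP.1 j; have := hz.1 j; have := I.B_nonneg d j
              have : 0 ≤ 1 - ε := by linarith
              split_ifs
              · exact le_of_eq (by ring)
              · rw [mul_zero]; positivity
          _ = (1 - ε) * ∑ j, I.B d j * y j + ε * ∑ j, I.B d j * z j := by
              rw [Finset.sum_add_distrib, Finset.mul_sum, Finset.mul_sum]
          _ ≤ (1 - ε) * 1 + ε * 1 := by
              have := hyP.2 d; have := hz.2 d
              gcongr
          _ = 1 := by ring
      · have := hypos j hj; have := hz.1 j
        have : 0 < 1 - ε := by linarith
        simp only [hj, if_true]
        positivity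
      · simp [hj]
    have hle := hmax _ hfeas
    have hterm : ∀ j ∈ J, ε * (w j * (a j / (1 + ε * a j))) ≤
        w j * Real.log (if j ∈ J then (1 - ε) * y j + ε * z j else 0)
          - w j * Real.log (y j) := by
      intro j hj
      have hyj := hypos j hj
      have hzj := hz.1 j
      have hfac : (1 - ε) * y j + ε * z j = y j * (1 + ε * a j) := by
        simp only [ha]; field_simp; ring
      have hpos : 0 < 1 + ε * a j := by
        have : 0 < (1 - ε) * y j + ε * z j := by
          have : 0 < 1 - ε := by linarith
          positivity
        rw [hfac] at this
        exact pos_of_mul_pos_right this hyj.le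
      have hlog := Real.one_sub_inv_le_log_of_pos hpos
      have heq : 1 - (1 + ε * a j)⁻¹ = ε * (a j / (1 + ε * a j)) := by field_simp; ring
      rw [if_pos hj, hfac, Real.log_mul hyj.ne' hpos.ne']
      rw [heq] at hlog
      have := mul_le_mul_of_nonneg_left hlog (hw j)
      linarith
    have hsum := Finset.sum_le_sum hterm
    rw [← Finset.mul_sum, Finset.sum_sub_distrib] at hsum
    by_contra! hcon
    have := mul_pos hε0 hcon
    linarith
  have hlim : Tendsto (fun ε : ℝ => ∑ j ∈ J, w j * (a j / (1 + ε * a j))) (𝓝[>] 0)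
      (𝓝 (∑ j ∈ J, w j * a j)) := by
    refine tendsto_finsetSum _ fun j _ => Tendsto.const_mul _ ?_
    have hc : ContinuousAt (fun ε : ℝ => a j / (1 + ε * a j)) 0 :=
      ContinuousAt.div (by fun_prop) (by fun_prop) (by simp)
    have := hc.tendsto
    simp only [zero_mul, add_zero, div_one] at this
    exact this.mono_left nhdsWithin_le_nhds
  have h0 : ∑ j ∈ J, w j * a j ≤ 0 := by
    refine le_of_tendsto hlim ?_
    filter_upwards [Ioo_mem_nhdsGT (zero_lt_one' ℝ)] with ε hε using key ε hε
  simp only [ha, mul_sub, mul_one, Finset.sum_sub_distrib] at h0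
  linarith

/-- Adding the first-order conditions of two maximizers gives
`∑ j ∈ J, w j * (z j / y j + y j / z j) ≤ 2 * ∑ j ∈ J, w j`, while `a + a⁻¹ ≥ 2` with equality only
at `a = 1`. -/
theorem IsPF.unique {I : PolytopeScheduling ι δ} {w : ι → ℝ} (hw : ∀ j, 0 < w j)
    {J : Finset ι} {y z : ι → ℝ} (hy : I.IsPF w J y) (hz : I.IsPF w J z) : y = z := by
  have h1 := hy.sum_mul_div_le (fun j => (hw j).le) hz.1.1
  have h2 := hz.sum_mul_div_le (fun j => (hw j).le) hy.1.1
  have hterm : ∀ j ∈ J, w j * (z j / y j) + w j * (y j / z j) - w j - w j =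
      w j * ((y j - z j) ^ 2 / (y j * z j)) := by
    intro j hj
    have := hy.1.2.1 j hj; have := hz.1.2.1 j hj
    field_simp; ring
  have hnn : ∀ j ∈ J, 0 ≤ w j * ((y j - z j) ^ 2 / (y j * z j)) := by
    intro j hj
    have := hy.1.2.1 j hj; have := hz.1.2.1 j hj; have := hw j
    positivity
  have hsum : ∑ j ∈ J, w j * ((y j - z j) ^ 2 / (y j * z j)) = 0 := by
    refine le_antisymm ?_ (Finset.sum_nonneg hnn)
    rw [← Finset.sum_congr rfl hterm]
    simp only [Finset.sum_sub_distrib, Finset.sum_add_distrib]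
    linarith
  funext j
  by_cases hj : j ∈ J
  · have := (Finset.sum_eq_zero_iff_of_nonneg hnn).1 hsum j hj
    have h3 := hy.1.2.1 j hj; have h4 := hz.1.2.1 j hj; have h5 := hw j
    have h6 : (y j - z j) ^ 2 = 0 := by
      rcases mul_eq_zero.1 this with h | h
      · exact absurd h h5.ne'
      · exact (div_eq_zero_iff.1 h).resolve_right (mul_pos h3 h4).ne'
    exact sub_eq_zero.1 (pow_eq_zero_iff two_ne_zero |>.1 h6)
  · rw [hy.1.2.2 j hj, hz.1.2.2 j hj]

/-! ### Active jobs -/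

theorem mem_active {I : PolytopeScheduling ι δ} {y : ℝ → ι → ℝ} {t : ℝ} {j : ι} :
    j ∈ I.active y t ↔ I.r j ≤ t ∧ ENNReal.ofReal t < I.completionTime y j := by
  simp [active]

theorem measurableSet_active (I : PolytopeScheduling ι δ) (y : ℝ → ι → ℝ) (j : ι) :
    MeasurableSet {t | j ∈ I.active y t} := by
  simp only [mem_active]
  exact measurableSet_Ici.inter
    (measurableSet_lt ENNReal.measurable_ofReal measurable_const)

/-- While it is active, a job receives no more than its processing requirement. -/
theorem setLIntegral_active_le (I : PolytopeScheduling ι δ) (y : ℝ → ι → ℝ) (j : ι) :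
    ∫⁻ t in {t | j ∈ I.active y t}, ENNReal.ofReal (y t j) ≤ ENNReal.ofReal (I.p j) := by
  -- a countable directed cover by intervals at whose right end the job is not yet complete
  let Q := {q : ℚ // I.r j ≤ q ∧ ENNReal.ofReal q < I.completionTime y j}
  have hsub : {t | j ∈ I.active y t} ⊆ ⋃ q : Q, Set.Icc (I.r j) (q.1 : ℝ) := by
    intro t ht
    obtain ⟨h1, h2⟩ := mem_active.1 ht
    have h0 : 0 ≤ t := (I.r_nonneg j).trans h1
    obtain ⟨c, hc1, hc2⟩ := exists_between h2
    have hcT : c ≠ ⊤ := hc2.ne_top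
    obtain ⟨q, hq1, hq2⟩ := exists_rat_btwn ((ENNReal.ofReal_lt_iff_lt_toReal h0 hcT).1 hc1)
    refine Set.mem_iUnion.2 ⟨⟨q, h1.trans hq1.le, lt_of_le_of_lt ?_ hc2⟩, h1, hq1.le⟩
    exact ENNReal.ofReal_le_of_le_toReal hq2.le
  refine (lintegral_mono_set hsub).trans ?_
  rw [setLIntegral_iUnion_of_directed]
  · refine iSup_le fun q => ?_
    by_contra! h
    exact q.2.2.not_ge (iInf₂_le (q.1 : ℝ) ⟨q.2.1, h.le⟩)
  · intro q q'
    rcases le_total q.1 q'.1 with h | h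
    · exact ⟨q', Set.Icc_subset_Icc_right (by exact_mod_cast h), le_rfl⟩
    · exact ⟨q, le_rfl, Set.Icc_subset_Icc_right (by exact_mod_cast h)⟩

/-! ### The duality argument -/

open Classical in
/-- What the analysis uses about a run of proportional fairness with an adversary. The completion
times are `C`, the sets of active and of nullified jobs are `A t` and `N t`, the allocation is
`y t`, and `ζ t` is a threshold for the relative rates `y t j / p j`. Active jobs of at least a
`lam`-fraction of the active weight have a relative rate of at most `ζ t` (`lower`), and active,
not nullified jobs of at least a `mu`-fraction of the active weight have a relative rate of at least
`ζ t` (`upper`). Apart from measurability, nothing is required of the rates and of the threshold at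
negative times. -/
structure IsPricedRun (I : PolytopeScheduling ι δ) (w : ι → ℝ) (lam mu : ℝ) (C : ι → ℝ≥0∞)
    (A N : ℝ → Finset ι) (y : ℝ → ι → ℝ) (ζ : ℝ → ℝ) : Prop where
  mem_iff : ∀ t j, j ∈ A t ↔ I.r j ≤ t ∧ ENNReal.ofReal t < C j
  measurable_N : ∀ j, MeasurableSet {t | j ∈ N t}
  measurable_y : ∀ j, Measurable fun t => y t j
  measurable_ζ : Measurable ζ
  pos : ∀ t, 0 ≤ t → ∀ j ∈ A t, 0 < y t j
  sum_mul_div_le : ∀ t, 0 ≤ t → ∀ z ∈ ratePolytope I.B,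
    ∑ j ∈ A t, w j * (z j / y t j) ≤ ∑ j ∈ A t, w j
  nonneg : ∀ t, 0 ≤ t → 0 ≤ ζ t
  lower : ∀ t, 0 ≤ t → lam * ∑ j ∈ A t, w j ≤ ∑ j ∈ A t with y t j ≤ ζ t * I.p j, w j
  upper : ∀ t, 0 ≤ t →
    mu * ∑ j ∈ A t, w j ≤ ∑ j ∈ A t with j ∉ N t ∧ ζ t * I.p j ≤ y t j, w j
  service : ∀ j, ∫⁻ t in {t | j ∈ A t}, ENNReal.ofReal (nullify y N t j) ≤ ENNReal.ofReal (I.p j)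

namespace IsPricedRun

variable {I : PolytopeScheduling ι δ} {w : ι → ℝ} {lam mu : ℝ} {C : ι → ℝ≥0∞}
  {A N : ℝ → Finset ι} {y : ℝ → ι → ℝ} {ζ : ℝ → ℝ}

theorem measurableSet_active (h : I.IsPricedRun w lam mu C A N y ζ) (j : ι) :
    MeasurableSet {t | j ∈ A t} := by
  simp only [h.mem_iff]
  exact measurableSet_Ici.inter
    (measurableSet_lt ENNReal.measurable_ofReal measurable_const)

theorem measurable_nullify (h : I.IsPricedRun w lam mu C A N y ζ) (j : ι) :
    Measurable fun t => nullify y N t j :=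
  Measurable.ite (h.measurable_N j) measurable_const (h.measurable_y j)

end IsPricedRun

/-- The times in `[0, T]` before the completion of `j` at which `j` is not yet released or has a
relative rate `y t j / p j` of at most `ζ t`. The weight of `j` times the measure of this set serves
as the dual variable of `j`. -/
def cheapTimes (I : PolytopeScheduling ι δ) (C : ι → ℝ≥0∞) (y : ℝ → ι → ℝ) (ζ : ℝ → ℝ) (T : ℝ)
    (j : ι) : Set ℝ :=
  {t | t ∈ timesBefore (C j) T ∧ (t < I.r j ∨ y t j ≤ ζ t * I.p j)}

/-- The integral of the price `w j / y t j` of job `j`, scaled by the threshold `ζ t`, over the times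
in `[v, T]` at which `j` is active. -/
noncomputable def accumulatedPrice (w : ι → ℝ) (A : ℝ → Finset ι) (y : ℝ → ι → ℝ) (ζ : ℝ → ℝ)
    (T : ℝ) (j : ι) (v : ℝ) : ℝ≥0∞ :=
  ∫⁻ t in Set.Icc v T ∩ {t | j ∈ A t}, ENNReal.ofReal (w j / y t j * ζ t)

namespace IsPricedRun

variable {I : PolytopeScheduling ι δ} {w : ι → ℝ} {lam mu : ℝ} {C : ι → ℝ≥0∞}
  {A N : ℝ → Finset ι} {y : ℝ → ι → ℝ} {ζ : ℝ → ℝ}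

theorem measurableSet_cheapTimes (h : I.IsPricedRun w lam mu C A N y ζ) (T : ℝ) (j : ι) :
    MeasurableSet (I.cheapTimes C y ζ T j) :=
  (measurableSet_timesBefore _ _).inter (measurableSet_Iio.union
    (measurableSet_le (h.measurable_y j) (h.measurable_ζ.mul_const _)))

/-- The dual variables recover a `lam`-fraction of the truncated cost: at every time, the unreleased
jobs count fully and the active ones by `IsPricedRun.lower`. -/
theorem le_sum_cheapTimes (h : I.IsPricedRun w lam mu C A N y ζ) (hw : ∀ j, 0 ≤ w j)
    (hlam : 0 ≤ lam) (hlam1 : lam ≤ 1) (T : ℝ) :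
    ENNReal.ofReal lam * ∑ j, ENNReal.ofReal (w j) * volume (timesBefore (C j) T) ≤
      ∑ j, ENNReal.ofReal (w j) * volume (I.cheapTimes C y ζ T j) := by
  classical
  rw [sum_ofReal_mul_volume hw fun j => measurableSet_timesBefore _ _,
    sum_ofReal_mul_volume hw fun j => h.measurableSet_cheapTimes T j,
    ← lintegral_const_mul' _ _ ENNReal.ofReal_ne_top]
  refine lintegral_mono fun t => ?_
  dsimp only
  rw [← ENNReal.ofReal_mul hlam]
  refine ENNReal.ofReal_le_ofReal ?_
  by_cases ht : 0 ≤ t ∧ t ≤ T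
  · have h1 : (Finset.univ.filter fun j => t ∈ timesBefore (C j) T) =
        A t ∪ Finset.univ.filter fun j => t < I.r j ∧ ENNReal.ofReal t < C j := by
      ext j
      simp only [timesBefore, Set.mem_ofPred_eq, Finset.mem_filter, Finset.mem_univ, true_and,
        Finset.mem_union, h.mem_iff, ht]
      have := le_or_gt (I.r j) t
      tauto
    have h2 : (Finset.univ.filter fun j => t ∈ I.cheapTimes C y ζ T j) =
        (A t).filter (fun j => y t j ≤ ζ t * I.p j) ∪
          Finset.univ.filter fun j => t < I.r j ∧ ENNReal.ofReal t < C j := by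
      ext j
      simp only [cheapTimes, timesBefore, Set.mem_ofPred_eq, Finset.mem_filter, Finset.mem_univ,
        true_and, Finset.mem_union, h.mem_iff, ht]
      have := le_or_gt (I.r j) t
      tauto
    have hd : Disjoint (A t)
        (Finset.univ.filter fun j => t < I.r j ∧ ENNReal.ofReal t < C j) := by
      refine Finset.disjoint_left.2 fun j hj hj' => ?_
      exact ((h.mem_iff t j).1 hj).1.not_gt (Finset.mem_filter.1 hj').2.1
    rw [h1, h2, Finset.sum_union hd,
      Finset.sum_union (hd.mono_left (Finset.filter_subset _ _)), mul_add]
    exact add_le_add (h.lower t ht.1)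
      (mul_le_of_le_one_left (Finset.sum_nonneg fun j _ => hw j) hlam1)
  · have h1 : (Finset.univ.filter fun j => t ∈ timesBefore (C j) T) = ∅ :=
      Finset.filter_eq_empty_iff.2 fun j _ hj => ht ⟨hj.1, hj.2.1⟩
    rw [h1, Finset.sum_empty, mul_zero]
    exact Finset.sum_nonneg fun j _ => hw j

/-- Feasibility of the dual variables. Past the time `v ≥ r j`, job `j` is active at each of its cheap
times, and there `w j` is at most `p j` times the scaled price of `j`. -/
theorem volume_cheapTimes_le (h : I.IsPricedRun w lam mu C A N y ζ) (hw : ∀ j, 0 ≤ w j) (T : ℝ)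
    {j : ι} {v : ℝ} (hv : I.r j ≤ v) :
    ENNReal.ofReal (w j) * volume (I.cheapTimes C y ζ T j) ≤
      ENNReal.ofReal (w j) * ENNReal.ofReal v +
        ENNReal.ofReal (I.p j) * accumulatedPrice w A y ζ T j v := by
  set S := I.cheapTimes C y ζ T j ∩ Set.Ici v with hS
  have hSm : MeasurableSet S := (h.measurableSet_cheapTimes T j).inter measurableSet_Ici
  have hsub : I.cheapTimes C y ζ T j ⊆ Set.Ico 0 v ∪ S := by
    intro t ht
    rcases lt_or_ge t v with hlt | hge
    · exact Or.inl ⟨ht.1.1, hlt⟩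
    · exact Or.inr ⟨ht, hge⟩
  have hmem : S ⊆ Set.Icc v T ∩ {t | j ∈ A t} := fun t ht =>
    ⟨⟨ht.2, ht.1.1.2.1⟩, (h.mem_iff t j).2 ⟨hv.trans ht.2, ht.1.1.2.2⟩⟩
  have hvol : volume (I.cheapTimes C y ζ T j) ≤ ENNReal.ofReal v + volume S := by
    refine (measure_mono hsub).trans ((measure_union_le _ _).trans ?_)
    rw [Real.volume_Ico, sub_zero]
  refine (mul_le_mul_right hvol _).trans ?_
  rw [mul_add]
  refine add_le_add_right ?_ _
  rw [← setLIntegral_const, accumulatedPrice, ← lintegral_const_mul' _ _ ENNReal.ofReal_ne_top]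
  refine (setLIntegral_mono' hSm fun t ht => ?_).trans (lintegral_mono_set hmem)
  have hjA : j ∈ A t := (hmem ht).2
  have hpos := h.pos t ht.1.1.1 j hjA
  have hle : y t j ≤ ζ t * I.p j :=
    ht.1.2.resolve_left ((h.mem_iff t j).1 hjA).1.not_gt
  rw [← ENNReal.ofReal_mul (I.p_pos j).le]
  refine ENNReal.ofReal_le_ofReal ?_
  calc w j = w j / y t j * y t j := by field_simp
    _ ≤ w j / y t j * (ζ t * I.p j) :=
      mul_le_mul_of_nonneg_left hle (div_nonneg (hw j) hpos.le)
    _ = I.p j * (w j / y t j * ζ t) := by ring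

/-- Dual feasibility averaged over a schedule `z` that processes `j` within `[r j, τ]`, where `z` is
slowed down by the factor `s`: what `z` does at time `u` is charged to the time `s * u`. -/
theorem volume_cheapTimes_le_of_schedule (h : I.IsPricedRun w lam mu C A N y ζ)
    (hw : ∀ j, 0 ≤ w j) (T : ℝ) {j : ι} {s : ℝ} (hs : 1 ≤ s) {z : ℝ → ι → ℝ} {τ : ℝ}
    (hτ : ENNReal.ofReal (I.p j) ≤ ∫⁻ u in Set.Icc (I.r j) τ, ENNReal.ofReal (z u j)) :
    ENNReal.ofReal (w j) * volume (I.cheapTimes C y ζ T j) ≤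
      ENNReal.ofReal (w j) * ENNReal.ofReal (s * τ) +
        ∫⁻ u in Set.Icc (I.r j) τ,
          ENNReal.ofReal (z u j) * accumulatedPrice w A y ζ T j (s * u) := by
  rw [← tsub_le_iff_left]
  set X := ENNReal.ofReal (w j) * volume (I.cheapTimes C y ζ T j) -
    ENNReal.ofReal (w j) * ENNReal.ofReal (s * τ) with hX
  have hXtop : X ≠ ⊤ := by
    refine (tsub_le_self.trans_lt (ENNReal.mul_lt_top ENNReal.ofReal_lt_top ?_)).ne
    exact (measure_mono fun _ ht => ht.1).trans_lt (volume_timesBefore_ne_top (C j) T).lt_top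
  have hpt : ∀ u ∈ Set.Icc (I.r j) τ,
      X ≤ ENNReal.ofReal (I.p j) * accumulatedPrice w A y ζ T j (s * u) := by
    intro u hu
    have hu0 : 0 ≤ u := (I.r_nonneg j).trans hu.1
    rw [hX, tsub_le_iff_left]
    refine (h.volume_cheapTimes_le hw T (v := s * u)
      (hu.1.trans (le_mul_of_one_le_left hu0 hs))).trans ?_
    gcongr
    exact hu.2
  -- `z` may process more than `p j`, which only strengthens the bound on the difference `X`
  have hp0 : ENNReal.ofReal (I.p j) ≠ 0 := by simpa using I.p_pos j
  refine (ENNReal.mul_le_mul_iff_right hp0 ENNReal.ofReal_ne_top).1 ?_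
  calc ENNReal.ofReal (I.p j) * X
      ≤ (∫⁻ u in Set.Icc (I.r j) τ, ENNReal.ofReal (z u j)) * X := by gcongr
    _ = ∫⁻ u in Set.Icc (I.r j) τ, ENNReal.ofReal (z u j) * X :=
        (lintegral_mul_const' _ _ hXtop).symm
    _ ≤ ∫⁻ u in Set.Icc (I.r j) τ, ENNReal.ofReal (I.p j) *
          (ENNReal.ofReal (z u j) * accumulatedPrice w A y ζ T j (s * u)) := by
        refine setLIntegral_mono' measurableSet_Icc fun u hu => ?_
        rw [mul_left_comm]
        gcongr
        exact hpt u hu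
    _ = _ := lintegral_const_mul' _ _ ENNReal.ofReal_ne_top

theorem sum_mul_accumulatedPrice_le (h : I.IsPricedRun w lam mu C A N y ζ)
    (hw : ∀ j, 0 ≤ w j) (T : ℝ) {x : ι → ℝ} (hx : x ∈ ratePolytope I.B) {v : ℝ} (hv : 0 ≤ v) :
    ∑ j, ENNReal.ofReal (x j) * accumulatedPrice w A y ζ T j v ≤
      ∫⁻ t in Set.Icc v T, ENNReal.ofReal (ζ t * ∑ j ∈ A t, w j) := by
  classical
  have hmeas : ∀ j, Measurable fun t => ENNReal.ofReal (w j / y t j * ζ t) := fun j =>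
    ENNReal.measurable_ofReal.comp
      ((measurable_const.div (h.measurable_y j)).mul h.measurable_ζ)
  have hrw : ∀ j, ENNReal.ofReal (x j) * accumulatedPrice w A y ζ T j v =
      ∫⁻ t in Set.Icc v T, {t | j ∈ A t}.indicator
        (fun t => ENNReal.ofReal (x j) * ENNReal.ofReal (w j / y t j * ζ t)) t := by
    intro j
    rw [accumulatedPrice, ← lintegral_const_mul' _ _ ENNReal.ofReal_ne_top,
      setLIntegral_indicator (h.measurableSet_active j), Set.inter_comm]
  simp_rw [hrw]
  rw [← lintegral_finsetSum _ fun j _ =>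
    ((hmeas j).const_mul _).indicator (h.measurableSet_active j)]
  refine setLIntegral_mono' measurableSet_Icc fun t ht => ?_
  have ht0 : 0 ≤ t := hv.trans ht.1
  have hterm : ∀ j ∈ A t, 0 ≤ ζ t * (w j * (x j / y t j)) := fun j hj =>
    mul_nonneg (h.nonneg t ht0) (mul_nonneg (hw j) (div_nonneg (hx.1 j) (h.pos t ht0 j hj).le))
  calc ∑ j, {t | j ∈ A t}.indicator
        (fun t => ENNReal.ofReal (x j) * ENNReal.ofReal (w j / y t j * ζ t)) t
      = ∑ j ∈ A t, ENNReal.ofReal (ζ t * (w j * (x j / y t j))) := by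
        rw [sum_indicator_setOf_mem]
        refine Finset.sum_congr rfl fun j _ => ?_
        rw [← ENNReal.ofReal_mul (hx.1 j)]
        congr 1
        ring
    _ = ENNReal.ofReal (ζ t * ∑ j ∈ A t, w j * (x j / y t j)) := by
        rw [Finset.mul_sum, ENNReal.ofReal_sum_of_nonneg hterm]
    _ ≤ _ := ENNReal.ofReal_le_ofReal
        (mul_le_mul_of_nonneg_left (h.sum_mul_div_le t ht0 x hx) (h.nonneg t ht0))

/-- By `IsPricedRun.upper`, the threshold is at most `1 / mu` times the weighted average of the
relative rates that remain after nullification. -/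
theorem price_mul_weight_le (h : I.IsPricedRun w lam mu C A N y ζ)
    (hw : ∀ j, 0 ≤ w j) (hmu : 0 < mu) {t : ℝ} (ht : 0 ≤ t) :
    ζ t * ∑ j ∈ A t, w j ≤ 1 / mu * ∑ j ∈ A t, w j / I.p j * nullify y N t j := by
  classical
  have h1 : ζ t * ∑ j ∈ A t with j ∉ N t ∧ ζ t * I.p j ≤ y t j, w j ≤
      ∑ j ∈ A t, w j / I.p j * nullify y N t j := by
    rw [Finset.mul_sum, Finset.sum_filter]
    refine Finset.sum_le_sum fun j hj => ?_
    have hp := I.p_pos j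
    have hy := h.pos t ht j hj
    have := hw j
    split_ifs with hc
    · have hn : nullify y N t j = y t j := if_neg hc.1
      calc ζ t * w j = w j / I.p j * (ζ t * I.p j) := by field_simp
        _ ≤ w j / I.p j * nullify y N t j := by rw [hn]; gcongr; exact hc.2
    · have hn : 0 ≤ nullify y N t j := by
        unfold nullify; split_ifs
        · exact le_rfl
        · exact hy.le
      positivity
  have h2 := mul_le_mul_of_nonneg_left (h.upper t ht) (h.nonneg t ht)
  rw [one_div, ← div_eq_inv_mul, le_div_iff₀ hmu]
  calc (ζ t * ∑ j ∈ A t, w j) * mu = ζ t * (mu * ∑ j ∈ A t, w j) := by ring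
    _ ≤ _ := h2.trans h1

/-- Each job unfinished at time `v` is processed to an extent of at most `p j` afterwards, so it
contributes at most its weight. -/
theorem lintegral_price_mul_weight_le (h : I.IsPricedRun w lam mu C A N y ζ)
    (hw : ∀ j, 0 ≤ w j) (hmu : 0 < mu) (T : ℝ) {v : ℝ} (hv : 0 ≤ v) :
    ∫⁻ t in Set.Icc v T, ENNReal.ofReal (ζ t * ∑ j ∈ A t, w j) ≤
      ENNReal.ofReal (1 / mu) *
        ∑ j, ENNReal.ofReal (w j) * (timesBefore (C j) T).indicator 1 v := by
  classical
  have hpt : ∀ t ∈ Set.Icc v T, ENNReal.ofReal (ζ t * ∑ j ∈ A t, w j) ≤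
      ENNReal.ofReal (1 / mu) * ∑ j, {t | j ∈ A t}.indicator
        (fun t => ENNReal.ofReal (w j / I.p j) * ENNReal.ofReal (nullify y N t j)) t := by
    intro t ht
    have ht0 := hv.trans ht.1
    refine (ENNReal.ofReal_le_ofReal (h.price_mul_weight_le hw hmu ht0)).trans_eq ?_
    rw [ENNReal.ofReal_mul (by positivity), ENNReal.ofReal_sum_of_nonneg]
    · rw [sum_indicator_setOf_mem]
      congr 1
      refine Finset.sum_congr rfl fun j _ => ?_
      rw [ENNReal.ofReal_mul (div_nonneg (hw j) (I.p_pos j).le)]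
    · intro j hj
      refine mul_nonneg (div_nonneg (hw j) (I.p_pos j).le) ?_
      unfold nullify; split_ifs
      · exact le_rfl
      · exact (h.pos t ht0 j hj).le
  refine (setLIntegral_mono' measurableSet_Icc hpt).trans ?_
  rw [lintegral_const_mul' _ _ ENNReal.ofReal_ne_top, lintegral_finsetSum _ fun j _ =>
    ((h.measurable_nullify j).ennreal_ofReal.const_mul _).indicator (h.measurableSet_active j)]
  gcongr with j
  rw [setLIntegral_indicator (h.measurableSet_active j),
    lintegral_const_mul' _ _ ENNReal.ofReal_ne_top]
  by_cases hvE : v ∈ timesBefore (C j) T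
  · rw [Set.indicator_of_mem hvE, Pi.one_apply, mul_one]
    calc _ ≤ ENNReal.ofReal (w j / I.p j) * ENNReal.ofReal (I.p j) := by
          gcongr
          exact (lintegral_mono_set Set.inter_subset_left).trans (h.service j)
      _ = ENNReal.ofReal (w j) := by
          rw [← ENNReal.ofReal_mul (div_nonneg (hw j) (I.p_pos j).le),
            div_mul_cancel₀ _ (I.p_pos j).ne']
  · have he : {t | j ∈ A t} ∩ Set.Icc v T = ∅ := by
      refine Set.eq_empty_of_forall_notMem fun t ht => hvE ⟨hv, ht.2.1.trans ht.2.2, ?_⟩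
      exact (ENNReal.ofReal_le_ofReal ht.2.1).trans_lt ((h.mem_iff t j).1 ht.1).2
    rw [he, setLIntegral_empty, mul_zero]
    exact zero_le

theorem lintegral_indicator_timesBefore (c : ℝ≥0∞) (T : ℝ) {s : ℝ} (hs : 0 < s) :
    ∫⁻ u, (timesBefore c T).indicator 1 (s * u) =
      ENNReal.ofReal (1 / s) * volume (timesBefore c T) := by
  have h1 := Real.volume_preimage_mul_left hs.ne' (timesBefore c T)
  rw [abs_of_pos (inv_pos.2 hs), ← one_div] at h1
  rw [← h1, ← lintegral_indicator_one]
  · rfl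
  · exact (measurable_const_mul s) (measurableSet_timesBefore c T)

/-- The bound from weak duality, on the costs truncated at `T`. Truncation keeps the left-hand side
finite even if some job is never completed in the run. -/
theorem le_of_schedule (h : I.IsPricedRun w lam mu C A N y ζ) (hw : ∀ j, 0 ≤ w j)
    (hlam : 0 ≤ lam) (hlam1 : lam ≤ 1) (hmu : 0 < mu) (T : ℝ) {s : ℝ} (hs : 1 ≤ s)
    {z : ℝ → ι → ℝ} (hz : I.IsSchedule z) {τ : ι → ℝ}
    (hτ : ∀ j, ENNReal.ofReal (I.p j) ≤
      ∫⁻ u in Set.Icc (I.r j) (τ j), ENNReal.ofReal (z u j)) :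
    ENNReal.ofReal lam * ∑ j, ENNReal.ofReal (w j) * volume (timesBefore (C j) T) ≤
      ∑ j, ENNReal.ofReal (w j) * ENNReal.ofReal (s * τ j) +
        ENNReal.ofReal (1 / mu) * ENNReal.ofReal (1 / s) *
          ∑ j, ENNReal.ofReal (w j) * volume (timesBefore (C j) T) := by
  have hs0 : 0 < s := by linarith
  refine (h.le_sum_cheapTimes hw hlam hlam1 T).trans ((Finset.sum_le_sum fun j _ =>
    h.volume_cheapTimes_le_of_schedule hw T hs (hτ j)).trans ?_)
  rw [Finset.sum_add_distrib]
  gcongr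
  have hGm : ∀ j, Measurable fun u =>
      ENNReal.ofReal (z u j) * accumulatedPrice w A y ζ T j (s * u) := by
    intro j
    have hanti : Antitone (accumulatedPrice w A y ζ T j) := fun v v' hvv' =>
      lintegral_mono_set (Set.inter_subset_inter_left _ (Set.Icc_subset_Icc_left hvv'))
    exact (ENNReal.measurable_ofReal.comp (hz.1 j)).mul
      (hanti.measurable.comp (measurable_const_mul s))
  calc ∑ j, ∫⁻ u in Set.Icc (I.r j) (τ j),
          ENNReal.ofReal (z u j) * accumulatedPrice w A y ζ T j (s * u)
      ≤ ∑ j, ∫⁻ u in Set.Ici 0,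
          ENNReal.ofReal (z u j) * accumulatedPrice w A y ζ T j (s * u) :=
        Finset.sum_le_sum fun j _ =>
          lintegral_mono_set fun u hu => (I.r_nonneg j).trans hu.1
    _ = ∫⁻ u in Set.Ici 0, ∑ j,
          ENNReal.ofReal (z u j) * accumulatedPrice w A y ζ T j (s * u) :=
        (lintegral_finsetSum _ fun j _ => hGm j).symm
    _ ≤ ∫⁻ u in Set.Ici 0, ENNReal.ofReal (1 / mu) *
          ∑ j, ENNReal.ofReal (w j) * (timesBefore (C j) T).indicator 1 (s * u) := by
        refine setLIntegral_mono' measurableSet_Ici fun u hu => ?_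
        have hv : 0 ≤ s * u := mul_nonneg hs0.le hu
        exact (h.sum_mul_accumulatedPrice_le hw T (hz.2 u hu) hv).trans
          (h.lintegral_price_mul_weight_le hw hmu T hv)
    _ ≤ ∫⁻ u, ENNReal.ofReal (1 / mu) *
          ∑ j, ENNReal.ofReal (w j) * (timesBefore (C j) T).indicator 1 (s * u) :=
        setLIntegral_le_lintegral _ _
    _ = _ := by
        rw [lintegral_const_mul' _ _ ENNReal.ofReal_ne_top, lintegral_finsetSum, mul_assoc,
          Finset.mul_sum Finset.univ _ (ENNReal.ofReal (1 / s))]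
        · congr 1
          refine Finset.sum_congr rfl fun j _ => ?_
          rw [lintegral_const_mul' _ _ ENNReal.ofReal_ne_top,
            lintegral_indicator_timesBefore _ _ hs0, mul_left_comm]
        · intro j _
          exact ((measurable_one.indicator (measurableSet_timesBefore _ _)).comp
            (measurable_const_mul s)).const_mul _

end IsPricedRun

/-! ### Competitive ratio -/

open Classical in
/-- A threshold as in `IsPricedRun` exists at a single time: a quantile of the relative rates of the
jobs that are not nullified. The nullified jobs can only add to the lower set. -/
theorem exists_price (I : PolytopeScheduling ι δ) {w : ι → ℝ} (hw : ∀ j, 0 < w j)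
    {β lam mu : ℝ} (hβ1 : β < 1) (hlam : 0 ≤ lam) (hmu : 0 ≤ mu) (hsum : lam + mu ≤ 1 - β)
    {J M : Finset ι} (hMJ : M ⊆ J) (hbudget : ∑ j ∈ M, w j ≤ β * ∑ j ∈ J, w j)
    {y : ι → ℝ} (hy : ∀ j ∈ J, 0 < y j) :
    ∃ ζ : ℝ, 0 ≤ ζ ∧ lam * ∑ j ∈ J, w j ≤ ∑ j ∈ J with y j ≤ ζ * I.p j, w j ∧
      mu * ∑ j ∈ J, w j ≤ ∑ j ∈ J with j ∉ M ∧ ζ * I.p j ≤ y j, w j := by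
  have hW : 0 ≤ ∑ j ∈ J, w j := Finset.sum_nonneg fun j _ => (hw j).le
  have hdiff : ∑ j ∈ J \ M, w j + ∑ j ∈ M, w j = ∑ j ∈ J, w j := Finset.sum_sdiff hMJ
  have hrest : (1 - β) * ∑ j ∈ J, w j ≤ ∑ j ∈ J \ M, w j := by linarith
  rcases (J \ M).eq_empty_or_nonempty with he | hne
  · -- if every active job is nullified, then there is no active job
    rw [he, Finset.sum_empty] at hrest
    have hW0 : ∑ j ∈ J, w j = 0 :=
      le_antisymm (nonpos_of_mul_nonpos_right hrest (by linarith)) hW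
    refine ⟨0, le_rfl, ?_, ?_⟩ <;> rw [hW0, mul_zero] <;>
      exact Finset.sum_nonneg fun j _ => (hw j).le
  · obtain ⟨i, hi, hlow, hup⟩ := exists_weighted_quantile hne w (fun j => y j / I.p j)
      (mul_nonneg hlam hW) (mul_nonneg hmu hW)
      (by rw [← add_mul]; exact (mul_le_mul_of_nonneg_right hsum hW).trans hrest)
    refine ⟨y i / I.p i, div_nonneg (hy i (Finset.sdiff_subset hi)).le (I.p_pos i).le,
      hlow.trans ?_, hup.trans ?_⟩
    · refine Finset.sum_le_sum_of_subset_of_nonneg (fun j hj => ?_) fun j _ _ => (hw j).le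
      rw [Finset.mem_filter] at hj ⊢
      exact ⟨Finset.sdiff_subset hj.1, (div_le_iff₀ (I.p_pos j)).1 hj.2⟩
    · refine Finset.sum_le_sum_of_subset_of_nonneg (fun j hj => ?_) fun j _ _ => (hw j).le
      rw [Finset.mem_filter, Finset.mem_sdiff] at hj
      rw [Finset.mem_filter]
      exact ⟨hj.1.1, hj.1.2, (le_div_iff₀ (I.p_pos j)).1 hj.2⟩

theorem IsRobustPFRun.exists_isPricedRun {I : PolytopeScheduling ι δ} {w : ι → ℝ}
    (hw : ∀ j, 0 < w j) {β lam mu : ℝ} (hβ1 : β < 1) (hlam : 0 ≤ lam) (hmu : 0 ≤ mu)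
    (hsum : lam + mu ≤ 1 - β) {y : ℝ → ι → ℝ} {N : ℝ → Finset ι} (h : I.IsRobustPFRun w y N)
    (hbudget : ∀ t, 0 ≤ t → ∑ j ∈ N t, w j ≤ β * ∑ j ∈ I.active (nullify y N) t, w j) :
    ∃ (y' : ℝ → ι → ℝ) (ζ : ℝ → ℝ), I.IsPricedRun w lam mu (I.completionTime (nullify y N))
      (I.active (nullify y N)) N y' ζ := by
  classical
  set A := I.active (nullify y N) with hA
  have hAm : ∀ j, MeasurableSet {t | j ∈ A t} := I.measurableSet_active _
  -- Allocation and threshold are chosen as functions of the pair `(A t, N t)`, which takes finitely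
  -- many values; this makes them measurable. Uniqueness of the allocation is needed for that.
  obtain ⟨Y, hY⟩ : ∃ Y : Finset ι → ι → ℝ, ∀ t, 0 ≤ t → y t = Y (A t) := by
    exact ⟨fun J => Classical.epsilon (I.IsPF w J), fun t ht =>
      (h.isPF t ht).unique hw (Classical.epsilon_spec ⟨_, h.isPF t ht⟩)⟩
  have hpf : ∀ t, 0 ≤ t → I.IsPF w (A t) (Y (A t)) := fun t ht => hY t ht ▸ h.isPF t ht
  obtain ⟨Z, hZ⟩ : ∃ Z : Finset ι × Finset ι → ℝ, ∀ t, 0 ≤ t → 0 ≤ Z (A t, N t) ∧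
      lam * ∑ j ∈ A t, w j ≤ ∑ j ∈ A t with Y (A t) j ≤ Z (A t, N t) * I.p j, w j ∧
      mu * ∑ j ∈ A t, w j ≤
        ∑ j ∈ A t with j ∉ N t ∧ Z (A t, N t) * I.p j ≤ Y (A t) j, w j := by
    let P : Finset ι × Finset ι → ℝ → Prop := fun S ζ => 0 ≤ ζ ∧
      lam * ∑ j ∈ S.1, w j ≤ ∑ j ∈ S.1 with Y S.1 j ≤ ζ * I.p j, w j ∧
      mu * ∑ j ∈ S.1, w j ≤ ∑ j ∈ S.1 with j ∉ S.2 ∧ ζ * I.p j ≤ Y S.1 j, w j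
    exact ⟨fun S => Classical.epsilon (P S), fun t ht =>
      Classical.epsilon_spec (p := P (A t, N t)) (I.exists_price hw hβ1 hlam hmu hsum
        (h.subset t ht) (hbudget t ht) (hpf t ht).1.2.1)⟩
  refine ⟨fun t => Y (A t), fun t => Z (A t, N t), fun t j => mem_active, h.measurable,
    fun j => ?_, ?_, fun t ht => (hpf t ht).1.2.1, fun t ht z hz => ?_,
    fun t ht => (hZ t ht).1, fun t ht => ?_, fun t ht => ?_, fun j => ?_⟩
  · exact measurable_comp_of_finite (measurableSet_fiber hAm) fun J => Y J j
  · refine measurable_comp_of_finite (σ := fun t => (A t, N t)) (fun S => ?_) Z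
    have : (fun t => (A t, N t)) ⁻¹' {S} = A ⁻¹' {S.1} ∩ N ⁻¹' {S.2} := by
      ext t
      simp [Prod.ext_iff]
    rw [this]
    exact (measurableSet_fiber hAm _).inter (measurableSet_fiber h.measurable _)
  · exact (hpf t ht).sum_mul_div_le (fun j => (hw j).le) hz
  · convert (hZ t ht).2.1
  · convert (hZ t ht).2.2
  · refine (setLIntegral_mono' (hAm j) fun t ht => ?_).trans
      (I.setLIntegral_active_le (nullify y N) j)
    have ht0 : 0 ≤ t := (I.r_nonneg j).trans (mem_active.1 ht).1
    simp only [nullify, hY t ht0, le_refl]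

theorem sum_mul_le_of_forall_timesBefore {w : ι → ℝ} {C : ι → ℝ≥0∞} {X : ℝ≥0∞}
    (h : ∀ T : ℝ, ∑ j, ENNReal.ofReal (w j) * volume (timesBefore (C j) T) ≤ X) :
    ∑ j, ENNReal.ofReal (w j) * C j ≤ X :=
  le_of_tendsto' (tendsto_finsetSum _ fun j _ =>
    ENNReal.Tendsto.const_mul (tendsto_volume_timesBefore (C j)) (Or.inr ENNReal.ofReal_ne_top))
    fun n : ℕ => h n

/-- Completion times are infima, so a bound in terms of times by which every job has been processed
passes to the cost. -/
theorem le_mul_cost (I : PolytopeScheduling ι δ) {w : ι → ℝ} (hw : ∀ j, 0 < w j)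
    {z : ℝ → ι → ℝ} {X : ℝ≥0∞} {c : ℝ} (hc : 0 < c)
    (h : ∀ τ : ι → ℝ, (∀ j, I.r j ≤ τ j ∧ ENNReal.ofReal (I.p j) ≤
        ∫⁻ u in Set.Icc (I.r j) (τ j), ENNReal.ofReal (z u j)) →
      X ≤ ENNReal.ofReal c * ∑ j, ENNReal.ofReal (w j) * ENNReal.ofReal (τ j)) :
    X ≤ ENNReal.ofReal c * I.cost w z := by
  by_cases hfin : ∀ j, I.completionTime z j ≠ ⊤
  · have hstep : ∀ ε : ℝ≥0∞, 0 < ε → X ≤ ENNReal.ofReal c *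
        ∑ j, ENNReal.ofReal (w j) * (I.completionTime z j + ε) := by
      intro ε hε
      have hex : ∀ j, ∃ t : ℝ, (I.r j ≤ t ∧ ENNReal.ofReal (I.p j) ≤
          ∫⁻ u in Set.Icc (I.r j) t, ENNReal.ofReal (z u j)) ∧
          ENNReal.ofReal t < I.completionTime z j + ε := by
        intro j
        have hlt := ENNReal.lt_add_right (hfin j) hε.ne'
        conv_lhs at hlt => rw [completionTime]
        simpa only [iInf_lt_iff, exists_prop] using hlt
      choose τ hτ hlt using hex
      refine (h τ hτ).trans ?_
      gcongr with j
      exact (hlt j).le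
    have hlim : Tendsto (fun ε : ℝ≥0∞ => ENNReal.ofReal c *
        ∑ j, ENNReal.ofReal (w j) * (I.completionTime z j + ε)) (𝓝[>] 0)
        (𝓝 (ENNReal.ofReal c * ∑ j, ENNReal.ofReal (w j) * (I.completionTime z j + 0))) := by
      refine ENNReal.Tendsto.const_mul (tendsto_finsetSum _ fun j _ => ?_)
        (Or.inr ENNReal.ofReal_ne_top)
      exact ENNReal.Tendsto.const_mul (tendsto_const_nhds.add
        (tendsto_id.mono_left nhdsWithin_le_nhds)) (Or.inr ENNReal.ofReal_ne_top)
    simp only [add_zero] at hlim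
    exact ge_of_tendsto hlim (eventually_mem_nhdsWithin.mono hstep)
  · push Not at hfin
    obtain ⟨j, hj⟩ := hfin
    have : I.cost w z = ⊤ := by
      refine ENNReal.sum_eq_top.2 ⟨j, Finset.mem_univ j, ?_⟩
      rw [hj, ENNReal.mul_top (by simpa using hw j)]
    rw [this, ENNReal.mul_top (by simpa using hc)]
    exact le_top

theorem IsRobustPFRun.cost_le {I : PolytopeScheduling ι δ} {w : ι → ℝ} (hw : ∀ j, 0 < w j)
    {β : ℝ} (hβ0 : 0 ≤ β) (hβ1 : β < 1) {y : ℝ → ι → ℝ} {N : ℝ → Finset ι}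
    (h : I.IsRobustPFRun w y N)
    (hbudget : ∀ t, 0 ≤ t → ∑ j ∈ N t, w j ≤ β * ∑ j ∈ I.active (nullify y N) t, w j) :
    I.cost w (nullify y N) ≤ ENNReal.ofReal (27 / (1 - β) ^ 3) * I.opt w := by
  set g := 1 - β with hg
  have hg0 : 0 < g := by linarith
  have hg1 : g ≤ 1 := by linarith
  -- With quantiles `lam`, `mu` and slow-down `s` the ratio is `s / (lam - 1 / (mu * s))`. For fixed
  -- `lam` and `mu` the best slow-down is `s = 2 / (lam * mu)`, which gives `4 / (lam ^ 2 * mu)`; under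
  -- `lam + mu = 1 - β` this is least at `lam = 2 * (1 - β) / 3`.
  obtain ⟨y', ζ, hrun⟩ := h.exists_isPricedRun hw hβ1 (lam := 2 * g / 3) (mu := g / 3)
    (by positivity) (by positivity) (by linarith) hbudget
  have hc : 0 < 27 / g ^ 3 := by positivity
  have hs : 1 ≤ 9 / g ^ 2 := by
    rw [le_div_iff₀ (by positivity)]
    nlinarith
  rw [opt, ENNReal.mul_iInf_of_ne (by simpa using hc) ENNReal.ofReal_ne_top]
  refine le_iInf fun z => ?_
  rw [ENNReal.mul_iInf_of_ne (by simpa using hc) ENNReal.ofReal_ne_top]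
  refine le_iInf fun hz => I.le_mul_cost hw hc fun τ hτ =>
    sum_mul_le_of_forall_timesBefore fun T => ?_
  have hmain := hrun.le_of_schedule (fun j => (hw j).le) (by positivity) (by linarith)
    (by positivity) T hs hz fun j => (hτ j).2
  set X := ∑ j, ENNReal.ofReal (w j) *
    volume (timesBefore (I.completionTime (nullify y N) j) T) with hX
  have hXtop : X ≠ ⊤ := ENNReal.sum_ne_top.2 fun j _ =>
    ENNReal.mul_ne_top ENNReal.ofReal_ne_top (volume_timesBefore_ne_top _ _)
  have hO : ∑ j, ENNReal.ofReal (w j) * ENNReal.ofReal (9 / g ^ 2 * τ j) =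
      ENNReal.ofReal (9 / g ^ 2) * ∑ j, ENNReal.ofReal (w j) * ENNReal.ofReal (τ j) := by
    rw [Finset.mul_sum]
    refine Finset.sum_congr rfl fun j _ => ?_
    rw [ENNReal.ofReal_mul (by positivity), mul_left_comm]
  rw [hO] at hmain
  set O := ∑ j, ENNReal.ofReal (w j) * ENNReal.ofReal (τ j) with hOdef
  have hOtop : O ≠ ⊤ := ENNReal.sum_ne_top.2 fun j _ =>
    ENNReal.mul_ne_top ENNReal.ofReal_ne_top ENNReal.ofReal_ne_top
  rw [← ENNReal.ofReal_toReal hXtop, ← ENNReal.ofReal_toReal hOtop] at hmain ⊢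
  have hX0 : 0 ≤ X.toReal := ENNReal.toReal_nonneg
  have hO0 : 0 ≤ O.toReal := ENNReal.toReal_nonneg
  generalize X.toReal = x at *
  generalize O.toReal = o at *
  rw [← ENNReal.ofReal_mul (by positivity), ← ENNReal.ofReal_mul (by positivity),
    ← ENNReal.ofReal_mul (by positivity), ← ENNReal.ofReal_mul (by positivity),
    ← ENNReal.ofReal_add (by positivity) (by positivity),
    ENNReal.ofReal_le_ofReal_iff (by positivity)] at hmain
  rw [← ENNReal.ofReal_mul (by positivity)]
  refine ENNReal.ofReal_le_ofReal ?_
  have h1 : 1 / (g / 3) * (1 / (9 / g ^ 2)) * x = g / 3 * x := by field_simp; norm_num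
  rw [h1] at hmain
  have h2 : g / 3 * x ≤ 9 / g ^ 2 * o := by linarith
  calc x = 3 / g * (g / 3 * x) := by field_simp
    _ ≤ 3 / g * (9 / g ^ 2 * o) := mul_le_mul_of_nonneg_left h2 (by positivity)
    _ = 27 / g ^ 3 * o := by field_simp; ring

end PolytopeScheduling

theorem mainTheorem3 {ι δ : Type*} [Fintype ι] [Fintype δ] (I : PolytopeScheduling ι δ)
    (β : ℝ) (hβ0 : 0 ≤ β) (hβ1 : β < 1) :
    -- total completion time: at most a `β`-fraction of the active jobs is nullified
    (∀ (y : ℝ → ι → ℝ) (N : ℝ → Finset ι), I.IsRobustPFRun (fun _ => 1) y N →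
      (∀ t, 0 ≤ t → ((N t).card : ℝ) ≤ β * ((I.active (nullify y N) t).card : ℝ)) →
      I.cost (fun _ => 1) (nullify y N) ≤
        ENNReal.ofReal (27 / (1 - β) ^ 3) * I.opt (fun _ => 1)) ∧
    -- total weighted completion time: at most a `β`-fraction of the active weight is nullified
    (∀ w : ι → ℝ, (∀ j, 0 < w j) →
      ∀ (y : ℝ → ι → ℝ) (N : ℝ → Finset ι), I.IsRobustPFRun w y N →
      (∀ t, 0 ≤ t → ∑ j ∈ N t, w j ≤ β * ∑ j ∈ I.active (nullify y N) t, w j) →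
      I.cost w (nullify y N) ≤ ENNReal.ofReal (27 / (1 - β) ^ 3) * I.opt w) := by
  refine ⟨fun y N h hbudget => h.cost_le (fun _ => one_pos) hβ0 hβ1 fun t ht => ?_,
    fun w hw y N h hbudget => h.cost_le hw hβ0 hβ1 hbudget⟩
  simpa using hbudget t ht
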